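/- Let $L(sl_2)=sl_2(\mathbb{C})\otimes\mathbb{C}[t,t^{-1}]$ be the $sl_2$ loop algebra, with generators $x_k^{+}=e\otimes t^k$, $x_k^{-}=f\otimes t^k$, $h_k=h\otimes t^k$ ($k\in\mathbb{Z}$), so that $[h_j,x_k^{\pm}]=\pm2x_{j+k}^{\pm}$, $[x_j^{+},x_k^{-}]=h_{j+k}$ and $[h_j,h_k]=[x_j^{\pm},x_k^{\pm}]=0$. Let $\Omega\neq0$ be a highest weight vector in a complex representation of $L(sl_2)$, that is, $x_k^{+}\Omega=0$ and $h_k\Omega\in\mathbb{C}\,\Omega$ for all $k\in\mathbb{Z}$, and assume that the subrepresentation $V_\Omega$ generated by $\Omega$ is finite-dimensional. Let $r\in\mathbb{Z}_{\ge0}$ be the eigenvalue of $h_0$ on $\Omega$, let $\lambda_j\in\mathbb{C}$ be defined by $$\frac{(x_0^{+})^{j}}{j!}\,\frac{(x_1^{-})^{j}}{j!}\,\Omega=\lambda_j\,\Omega\qquad(0\le j\le r),$$ and put $P_\Omega(u)=\sum_{k=0}^{r}\lambda_k(-u)^k$. Let $a_1,\dots,a_s$ be the evaluation parameters of $\Omega$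 and $m_1,\dots,m_s$ their multiplicities, that is, $$P_\Omega(u)=\prod_{j=1}^{s}(1-a_ju)^{m_j}$$ with $a_1,\dots,a_s\in\mathbb{C}$ distinct and nonzero and with integers $m_j\ge1$. Put $$x_s^{-}(\boldsymbol a)=\sum_{k=0}^{s}(-1)^k\Bigl(\sum_{1\le i_1<\cdots<i_k\le s}a_{i_1}\cdots a_{i_k}\Bigr)x_{s-k}^{-}.$$ Then $V_\Omega$ is irreducible if and only if $x_s^{-}(\boldsymbol a)\,\Omega=0$. -/

import Mathlib

open scoped TensorProduct

noncomputable section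

namespace Sl2Loop

/-- The Lie algebra `sl₂(ℂ)` of traceless complex `2 × 2` matrices. -/
abbrev Sl2 : Type := LieAlgebra.SpecialLinear.sl (Fin 2) ℂ

/-- The `sl₂` loop algebra `L(sl₂) = ℂ[t, t⁻¹] ⊗ sl₂(ℂ)`. Its representations, i.e. those of its
universal enveloping algebra, are its Lie modules. -/
abbrev LoopSl2 : Type := LieAlgebra.loopAlgebra ℂ ℤ Sl2

/-- The matrix unit `E₁₂`. -/
def e : Sl2 := LieAlgebra.SpecialLinear.single (R := ℂ) (0 : Fin 2) 1 (by decide) 1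

/-- The matrix unit `E₂₁`. -/
def f : Sl2 := LieAlgebra.SpecialLinear.single (R := ℂ) (1 : Fin 2) 0 (by decide) 1

/-- The diagonal matrix `E₁₁ - E₂₂`. -/
def h : Sl2 := LieAlgebra.SpecialLinear.singleSubSingle (R := ℂ) (0 : Fin 2) 1 1

/-- The element `tᵏ ⊗ y` of the loop algebra. -/
def gen (y : Sl2) (k : ℤ) : LoopSl2 := (AddMonoidAlgebra.single k (1 : ℂ)) ⊗ₜ[ℂ] y

/-- The generator `x_k⁺ = tᵏ ⊗ e`. -/
def xPlus (k : ℤ) : LoopSl2 := gen e k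

/-- The generator `x_k⁻ = tᵏ ⊗ f`. -/
def xMinus (k : ℤ) : LoopSl2 := gen f k

/-- The generator `h_k = tᵏ ⊗ h`. -/
def hGen (k : ℤ) : LoopSl2 := gen h k

theorem gen_lie_gen (y z : Sl2) (j k : ℤ) : ⁅gen y j, gen z k⁆ = gen ⁅y, z⁆ (j + k) := by
  unfold gen
  rw [LieAlgebra.ExtendScalars.bracket_tmul, AddMonoidAlgebra.single_mul_single, one_mul]

theorem e_lie_f : ⁅e, f⁆ = h := by
  apply Subtype.ext
  ext i j
  fin_cases i <;> fin_cases j <;> simp [e, f, h, Ring.lie_def]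

theorem h_lie_e : ⁅h, e⁆ = (2 : ℂ) • e := by
  apply Subtype.ext
  ext i j
  fin_cases i <;> fin_cases j <;> norm_num [e, h, Ring.lie_def]

theorem h_lie_f : ⁅h, f⁆ = (-2 : ℂ) • f := by
  apply Subtype.ext
  ext i j
  fin_cases i <;> fin_cases j <;> norm_num [f, h, Ring.lie_def]

theorem hGen_lie_xPlus (j k : ℤ) : ⁅hGen j, xPlus k⁆ = (2 : ℂ) • xPlus (j + k) := by
  rw [hGen, xPlus, gen_lie_gen, h_lie_e]
  exact TensorProduct.tmul_smul _ _ _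

theorem hGen_lie_xMinus (j k : ℤ) : ⁅hGen j, xMinus k⁆ = (-2 : ℂ) • xMinus (j + k) := by
  rw [hGen, xMinus, gen_lie_gen, h_lie_f]
  exact TensorProduct.tmul_smul _ _ _

theorem xPlus_lie_xMinus (j k : ℤ) : ⁅xPlus j, xMinus k⁆ = hGen (j + k) := by
  rw [xPlus, xMinus, gen_lie_gen, e_lie_f, hGen]

theorem gen_lie_gen_self (y : Sl2) (j k : ℤ) : ⁅gen y j, gen y k⁆ = 0 := by
  rw [gen_lie_gen, lie_self, gen, TensorProduct.tmul_zero]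

/-- The generator with parameters
`x_m⁻(α) = ∑_{k=0}^{m} (-1)ᵏ e_k(α₁, …, α_m) x_{m-k}⁻`, where `e_k` is the `k`-th elementary
symmetric polynomial. -/
def xMinusParam {m : ℕ} (α : Fin m → ℂ) : LoopSl2 :=
  ∑ k ∈ Finset.range (m + 1),
    ((-1 : ℂ) ^ k * ∑ I ∈ Finset.powersetCard k (Finset.univ : Finset (Fin m)), ∏ i ∈ I, α i) •
      xMinus ((m : ℤ) - (k : ℤ))

variable {V : Type*} [AddCommGroup V] [Module ℂ V] [LieRingModule LoopSl2 V]

/-- A highest weight vector: a nonzero vector annihilated by all `x_k⁺`, and a simultaneous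
eigenvector of all `h_k`, `k ∈ ℤ`. -/
structure IsHighestWeightVector (Ω : V) : Prop where
  ne_zero : Ω ≠ 0
  xPlus_lie (k : ℤ) : ⁅xPlus k, Ω⁆ = 0
  hGen_lie (k : ℤ) : ∃ d : ℂ, ⁅hGen k, Ω⁆ = d • Ω

/-- The representation `V_Ω` generated by `Ω`. -/
abbrev genRep (Ω : V) : LieSubmodule ℂ LoopSl2 V := LieSubmodule.lieSpan ℂ LoopSl2 {Ω}

variable [LieModule ℂ LoopSl2 V]

/-- The operator `y^(n) = yⁿ / n!` on a representation. -/
def divPow (y : LoopSl2) (n : ℕ) : V →ₗ[ℂ] V :=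
  ((n.factorial : ℂ)⁻¹) • (LieModule.toEnd ℂ LoopSl2 V y) ^ n

/-- The number `r` with `h₀ Ω = r Ω`. It exists and is unique if `Ω` is a highest weight vector
that generates a finite-dimensional representation. -/
def weight (Ω : V) : ℕ := Classical.epsilon fun r : ℕ => ⁅hGen 0, Ω⁆ = (r : ℂ) • Ω

/-- The number `λ_j` with `(x₀⁺)^(j) (x₁⁻)^(j) Ω = λ_j Ω`. It exists and is unique if `Ω` is a
highest weight vector. -/
def eigenval (Ω : V) (j : ℕ) : ℂ :=
  Classical.epsilon fun c : ℂ => divPow (xPlus 0) j (divPow (xMinus 1) j Ω) = c • Ω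

/-- The Drinfeld polynomial `P_Ω(u) = ∑_{k=0}^{r} λ_k (-u)ᵏ`. -/
def drinfeldPoly (Ω : V) : Polynomial ℂ :=
  ∑ k ∈ Finset.range (weight Ω + 1), Polynomial.C (eigenval Ω k) * (-Polynomial.X) ^ k

/-- `Ω` has the evaluation parameters `a₁, …, a_s` with the multiplicities `m₁, …, m_s`: the `a_j`
are distinct and nonzero, the `m_j` are positive, and `P_Ω(u) = ∏_j (1 - a_j u)^{m_j}`. -/
structure HasEvaluationParameters (Ω : V) {s : ℕ} (a : Fin s → ℂ) (m : Fin s → ℕ) : Prop where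
  injective : Function.Injective a
  ne_zero (j : Fin s) : a j ≠ 0
  mult_pos (j : Fin s) : 0 < m j
  factorization : drinfeldPoly Ω =
    ∏ j : Fin s, (1 - Polynomial.C (a j) * Polynomial.X) ^ m j

end Sl2Loop

end

/-! Write `E p`, `F p`, `H p` for the action of `p ⊗ e`, `p ⊗ f`, `p ⊗ h`, with `p` a Laurent
polynomial, on the finite-dimensional representation generated by `Ω`. The `p` with `F p Ω = 0` form
an ideal, and it acts as zero on the whole representation. By Vieta, `x_s⁻(a) Ω = 0` says that `∏ (X
- a_i)` lies in this ideal, so the theorem compares the ideal with the roots of the Drinfeld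
polynomial.

If the product lies in the ideal, the Lagrange basis at the `a_i` splits `1` into idempotents `l`,
each giving an `sl₂` triple whose Casimir operator is scalar (`casimir_apply`). A nonzero invariant
subspace contains a nonzero space killed by all `E p` and stable under all `H p`. There the Casimir
operator and finite dimension force `H l` to take its value on `Ω`. Summing over `l`, this space has
top weight, so it is the line of `Ω` (`irred_of_sum_eq_one`).

Conversely, irreducibility makes the ideal radical (`F_apply_eq_zero_of_sq`), so its polynomial
generator `q` has simple nonzero roots. Each root `b` gives an idempotent of positive weight `n`,
which contributes a factor `(1 - b u)ⁿ` to the Drinfeld polynomial (`sum_eigenvalues_eq_zero`). So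
`b` is some `a_i`, and `q` divides `∏ (X - a_i)`. -/

namespace Sl2Loop

open Module

/-! ### Primitive vectors of a single `sl₂` triple -/

section SingleTriple

variable {M : Type*} [AddCommGroup M] [Module ℂ M] {e f h : End ℂ M}

theorem weight_pow_apply (hhf : ∀ v, h (f v) = f (h v) - (2 : ℂ) • f v) {μ : ℂ} {v : M}
    (hv : h v = μ • v) (n : ℕ) : h ((f ^ n) v) = (μ - 2 * n) • (f ^ n) v := by
  induction n with
  | zero => simpa using hv
  | succ n ih =>
    rw [pow_succ', Module.End.mul_apply, hhf, ih, map_smul, ← sub_smul]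
    congr 1
    push_cast
    ring

/-- In a finite-dimensional space, an operator lowering the eigenvalues of `h` by `2` acts
nilpotently on every eigenvector of `h`. -/
theorem exists_pow_apply_eq_zero [FiniteDimensional ℂ M]
    (hhf : ∀ v, h (f v) = f (h v) - (2 : ℂ) • f v) {μ : ℂ} {v : M} (hv : h v = μ • v) :
    ∃ n : ℕ, (f ^ n) v = 0 := by
  by_contra! hne
  have hinj : Function.Injective fun n : ℕ => μ - 2 * (n : ℂ) := by
    intro m n hmn
    have : (m : ℂ) = n := by linear_combination (-1 / 2 : ℂ) * hmn
    exact_mod_cast this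
  have hind := Module.End.eigenvectors_linearIndependent' h _ hinj (fun n => (f ^ n) v)
    fun n => ⟨Module.End.mem_eigenspace_iff.mpr (weight_pow_apply hhf hv n), hne n⟩
  exact not_finite_iff_infinite.mpr inferInstance hind.finite

/-- Moving `e` past each `f` collects the weights `μ - 2i` for `0 ≤ i ≤ n`, whose sum is `(n + 1)(μ
- n)`. -/
theorem raise_pow_succ_apply (hef : ∀ v, e (f v) = f (e v) + h v)
    (hhf : ∀ v, h (f v) = f (h v) - (2 : ℂ) • f v) {μ : ℂ} {v : M}
    (hv : h v = μ • v) (hev : e v = 0) (n : ℕ) :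
    e ((f ^ (n + 1)) v) = ((n + 1) * (μ - n)) • (f ^ n) v := by
  induction n with
  | zero => simp [hef, hev, hv]
  | succ n ih =>
    rw [pow_succ', Module.End.mul_apply, hef, ih, weight_pow_apply hhf hv, map_smul,
      ← Module.End.mul_apply, ← pow_succ', ← add_smul]
    congr 1
    push_cast
    ring

/-- The weight of a primitive vector of a finite-dimensional representation of `sl₂` is a natural
number. -/
theorem exists_weight_eq_natCast [FiniteDimensional ℂ M] (hef : ∀ v, e (f v) = f (e v) + h v)
    (hhf : ∀ v, h (f v) = f (h v) - (2 : ℂ) • f v) {μ : ℂ} {v : M}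
    (hv : h v = μ • v) (hev : e v = 0) (hne : v ≠ 0) : ∃ n : ℕ, μ = n := by
  classical
  have hex := exists_pow_apply_eq_zero hhf hv
  obtain ⟨n, hn⟩ : ∃ n, Nat.find hex = n + 1 := by
    refine Nat.exists_eq_succ_of_ne_zero fun h0 => hne ?_
    simpa [h0] using Nat.find_spec hex
  have h1 := Nat.find_spec hex
  have h2 := Nat.find_min hex (m := n) (by omega)
  have h3 := raise_pow_succ_apply hef hhf hv hev n
  rw [← hn, h1, map_zero, eq_comm, smul_eq_zero, or_iff_left h2, mul_eq_zero,
    or_iff_right (by exact_mod_cast n.succ_ne_zero)] at h3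
  exact ⟨n, sub_eq_zero.mp h3⟩

theorem pow_succ_apply_eq_zero [FiniteDimensional ℂ M] (hef : ∀ v, e (f v) = f (e v) + h v)
    (hhf : ∀ v, h (f v) = f (h v) - (2 : ℂ) • f v) {n : ℕ} {v : M}
    (hv : h v = (n : ℂ) • v) (hev : e v = 0) : (f ^ (n + 1)) v = 0 := by
  by_contra hne
  -- The vector `f ^ (n + 1) v` is primitive of weight `-n - 2`, which is not a natural number.
  obtain ⟨k, hk⟩ := exists_weight_eq_natCast hef hhf (weight_pow_apply hhf hv (n + 1))
    (by rw [raise_pow_succ_apply hef hhf hv hev]; simp) hne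
  have : ((k + n + 2 : ℕ) : ℂ) = 0 := by
    push_cast at hk ⊢
    linear_combination -hk
  exact absurd this (by exact_mod_cast (Nat.succ_ne_zero (k + n + 1)))

/-- With divided powers only `n.choose k` remains, the coefficient of `uᵏ` in `(1 + u)ⁿ`; this is
the source of the factors of the Drinfeld polynomial. -/
theorem raise_pow_lower_pow_apply (hef : ∀ v, e (f v) = f (e v) + h v)
    (hhf : ∀ v, h (f v) = f (h v) - (2 : ℂ) • f v) {n : ℕ} {v : M}
    (hv : h v = (n : ℂ) • v) (hev : e v = 0) (k : ℕ) :
    (e ^ k) ((f ^ k) v) = ((k.factorial : ℂ) ^ 2 * n.choose k) • v := by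
  induction k with
  | zero => simp
  | succ k ih =>
    rw [pow_succ e, Module.End.mul_apply, raise_pow_succ_apply hef hhf hv hev, map_smul, ih,
      smul_smul]
    congr 1
    have hc : ((n.choose (k + 1) : ℕ) : ℂ) * (k + 1) = n.choose k * (n - k) := by
      rcases le_or_gt k n with hkn | hkn
      · rw [← Nat.cast_sub hkn]
        exact_mod_cast Nat.choose_succ_right_eq n k
      · simp [Nat.choose_eq_zero_of_lt hkn, Nat.choose_eq_zero_of_lt (Nat.lt_succ_of_lt hkn)]
    rw [Nat.factorial_succ]
    push_cast
    linear_combination (-(k.factorial : ℂ) ^ 2 * (k + 1)) * hc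

end SingleTriple

/-- A representation on `M` of the current algebra `A ⊗ sl₂`, given by the operators `E p`, `F p`,
`H p` by which `p ⊗ e`, `p ⊗ f`, `p ⊗ h` act. -/
structure CurrentRep (A M : Type*) [CommRing A] [Algebra ℂ A] [AddCommGroup M] [Module ℂ M] where
  E : A →ₗ[ℂ] End ℂ M
  F : A →ₗ[ℂ] End ℂ M
  H : A →ₗ[ℂ] End ℂ M
  E_F (p q : A) (v : M) : E p (F q v) = F q (E p v) + H (p * q) v
  H_E (p q : A) (v : M) : H p (E q v) = E q (H p v) + (2 : ℂ) • E (p * q) v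
  H_F (p q : A) (v : M) : H p (F q v) = F q (H p v) - (2 : ℂ) • F (p * q) v
  E_E (p q : A) (v : M) : E p (E q v) = E q (E p v)
  F_F (p q : A) (v : M) : F p (F q v) = F q (F p v)
  H_H (p q : A) (v : M) : H p (H q v) = H q (H p v)

/-! ### Invariant subspaces and their weights -/

namespace CurrentRep

variable {A M : Type*} [CommRing A] [Algebra ℂ A] [AddCommGroup M] [Module ℂ M]
  (ρ : CurrentRep A M)

/-- Invariance of a subspace under the current algebra. -/
structure Stable (N : Submodule ℂ M) : Prop where
  E_mem (p : A) {v : M} : v ∈ N → ρ.E p v ∈ N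
  F_mem (p : A) {v : M} : v ∈ N → ρ.F p v ∈ N
  H_mem (p : A) {v : M} : v ∈ N → ρ.H p v ∈ N

/-- `ρ` has no invariant subspaces but `⊥` and `⊤`. -/
def Irred : Prop := ∀ N : Submodule ℂ M, ρ.Stable N → N ≠ ⊥ → N = ⊤

/-- The span of the vectors `F p₁ ⋯ F pₙ b` with `b ∈ B`. -/
def lowered (B : Submodule ℂ M) : ℕ → Submodule ℂ M
  | 0 => B
  | n + 1 => ⨆ p : A, (lowered B n).map (ρ.F p)

/-- A subspace annihilated by all `E p`, invariant under all `H p`, and of weight `μ`. -/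
structure IsPrimitive (B : Submodule ℂ M) (μ : ℂ) : Prop where
  E_eq_zero (p : A) {v : M} : v ∈ B → ρ.E p v = 0
  H_mem (p : A) {v : M} : v ∈ B → ρ.H p v ∈ B
  H_one {v : M} : v ∈ B → ρ.H 1 v = μ • v

variable {ρ} {B : Submodule ℂ M} {μ : ℂ}

theorem F_mem_lowered (p : A) {n : ℕ} {v : M} (hv : v ∈ ρ.lowered B n) :
    ρ.F p v ∈ ρ.lowered B (n + 1) :=
  Submodule.mem_iSup_of_mem p (Submodule.mem_map_of_mem hv)

theorem lowered_succ_le {n : ℕ} {N : Submodule ℂ M}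
    (h : ∀ p : A, ∀ v ∈ ρ.lowered B n, ρ.F p v ∈ N) : ρ.lowered B (n + 1) ≤ N :=
  iSup_le fun p => Submodule.map_le_iff_le_comap.mpr (h p)

theorem pow_F_mem_lowered (p : A) {v : M} (hv : v ∈ B) (n : ℕ) :
    (ρ.F p ^ n) v ∈ ρ.lowered B n := by
  induction n with
  | zero => exact hv
  | succ n ih =>
    rw [pow_succ', Module.End.mul_apply]
    exact F_mem_lowered p ih

namespace IsPrimitive

variable (hB : ρ.IsPrimitive B μ)
include hB

theorem H_mem_lowered (p : A) {n : ℕ} {v : M} (hv : v ∈ ρ.lowered B n) :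
    ρ.H p v ∈ ρ.lowered B n := by
  induction n generalizing p v with
  | zero => exact hB.H_mem p hv
  | succ n ih =>
    refine lowered_succ_le (N := (ρ.lowered B (n + 1)).comap (ρ.H p)) (fun q w hw => ?_) hv
    rw [Submodule.mem_comap, ρ.H_F]
    exact sub_mem (F_mem_lowered q (ih p hw)) (Submodule.smul_mem _ _ (F_mem_lowered _ hw))

theorem E_mem_lowered (p : A) {n : ℕ} {v : M} (hv : v ∈ ρ.lowered B (n + 1)) :
    ρ.E p v ∈ ρ.lowered B n := by
  induction n generalizing p v with
  | zero =>
    refine lowered_succ_le (N := (ρ.lowered B 0).comap (ρ.E p)) (fun q w hw => ?_) hv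
    rw [Submodule.mem_comap, ρ.E_F, hB.E_eq_zero p hw, map_zero, zero_add]
    exact hB.H_mem_lowered _ hw
  | succ n ih =>
    refine lowered_succ_le (N := (ρ.lowered B (n + 1)).comap (ρ.E p)) (fun q w hw => ?_) hv
    rw [Submodule.mem_comap, ρ.E_F]
    exact add_mem (F_mem_lowered q (ih p hw)) (hB.H_mem_lowered _ hw)

theorem H_one_lowered {n : ℕ} {v : M} (hv : v ∈ ρ.lowered B n) :
    ρ.H 1 v = (μ - 2 * n) • v := by
  induction n generalizing v with
  | zero => simpa using hB.H_one hv
  | succ n ih =>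
    refine Module.End.mem_eigenspace_iff.mp (lowered_succ_le (fun q w hw => ?_) hv)
    rw [Module.End.mem_eigenspace_iff, ρ.H_F, ih hw, map_smul, one_mul, ← sub_smul]
    congr 1
    push_cast
    ring

theorem stable_iSup_lowered : ρ.Stable (⨆ n, ρ.lowered B n) where
  E_mem p v hv := by
    refine (iSup_le fun n => ?_ : _ ≤ (⨆ n, ρ.lowered B n).comap (ρ.E p)) hv
    intro w hw
    rw [Submodule.mem_comap]
    cases n with
    | zero => rw [hB.E_eq_zero p hw]; exact zero_mem _
    | succ n => exact Submodule.mem_iSup_of_mem n (hB.E_mem_lowered p hw)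
  F_mem p v hv := by
    refine (iSup_le fun n => ?_ : _ ≤ (⨆ n, ρ.lowered B n).comap (ρ.F p)) hv
    exact fun w hw => Submodule.mem_iSup_of_mem (n + 1) (F_mem_lowered p hw)
  H_mem p v hv := by
    refine (iSup_le fun n => ?_ : _ ≤ (⨆ n, ρ.lowered B n).comap (ρ.H p)) hv
    exact fun w hw => Submodule.mem_iSup_of_mem n (hB.H_mem_lowered p hw)

/-- Each `lowered B n` lies in a single eigenspace of `H 1`, and eigenspaces are independent. -/
theorem disjoint_lowered_eigenspace {ν : ℂ} {k : ℕ} (hν : ∀ n : ℕ, μ - 2 * (n + k : ℕ) ≠ ν) :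
    Disjoint ((ρ.H 1).eigenspace ν) (⨆ n, ρ.lowered B (n + k)) := by
  refine ((ρ.H 1).eigenspaces_iSupIndep ν).mono_right (iSup_le fun n => ?_)
  refine le_iSup₂_of_le (μ - 2 * (n + k : ℕ)) (hν n) fun v hv => ?_
  exact Module.End.mem_eigenspace_iff.mpr (hB.H_one_lowered hv)

/-- The vectors of top weight in the invariant subspace generated by `B` are those of `B`. -/
theorem mem_of_H_one {v : M} (hv : v ∈ ⨆ n, ρ.lowered B n) (hw : ρ.H 1 v = μ • v) : v ∈ B := by
  rw [← sup_iSup_nat_succ, Submodule.mem_sup] at hv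
  obtain ⟨b, hb, w, hw', rfl⟩ := hv
  have hw1 : ρ.H 1 w = μ • w := by
    rw [map_add, smul_add, hB.H_one hb] at hw
    exact add_left_cancel hw
  have hd := hB.disjoint_lowered_eigenspace (ν := μ) (k := 1) fun n h => by
    have : ((n + 1 : ℕ) : ℂ) = 0 := by linear_combination (-1 / 2 : ℂ) * h
    exact absurd this (by exact_mod_cast n.succ_ne_zero)
  rw [Submodule.disjoint_def.mp hd w (Module.End.mem_eigenspace_iff.mpr hw1) hw', add_zero]
  exact hb

end IsPrimitive

/-- `Ω` is a highest weight vector, with `H p Ω = D p • Ω`, that generates the representation. -/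
structure IsHighest (ρ : CurrentRep A M) (Ω : M) (D : A → ℂ) : Prop where
  ne_zero : Ω ≠ 0
  E_apply (p : A) : ρ.E p Ω = 0
  H_apply (p : A) : ρ.H p Ω = D p • Ω
  generates (N : Submodule ℂ M) : ρ.Stable N → Ω ∈ N → N = ⊤

/-- `l` is, modulo the kernel of the representation generated by `Ω`, an idempotent of `A` that spans
an ideal of dimension at most one. -/
structure IsMinimalIdempotent (ρ : CurrentRep A M) (Ω : M) (l : A) : Prop where
  sq : ρ.F (l * l - l) Ω = 0
  mul (p : A) : ∃ c : ℂ, ρ.F (l * p - c • l) Ω = 0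

/-! ### The kernel ideal, the Casimir operator and a criterion for irreducibility -/

namespace IsHighest

variable {Ω : M} {D : A → ℂ} (hΩ : ρ.IsHighest Ω D)
include hΩ

theorem isPrimitive_span : ρ.IsPrimitive (Submodule.span ℂ {Ω}) (D 1) where
  E_eq_zero p v hv := by
    obtain ⟨c, rfl⟩ := Submodule.mem_span_singleton.mp hv
    rw [map_smul, hΩ.E_apply, smul_zero]
  H_mem p v hv := by
    obtain ⟨c, rfl⟩ := Submodule.mem_span_singleton.mp hv
    rw [map_smul, hΩ.H_apply]
    exact Submodule.smul_mem _ _ (Submodule.smul_mem _ _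
      (Submodule.mem_span_singleton_self Ω))
  H_one hv := by
    obtain ⟨c, rfl⟩ := Submodule.mem_span_singleton.mp hv
    rw [map_smul, hΩ.H_apply, smul_comm]

theorem iSup_lowered_eq_top : ⨆ n, ρ.lowered (Submodule.span ℂ {Ω}) n = ⊤ :=
  hΩ.generates _ hΩ.isPrimitive_span.stable_iSup_lowered
    (Submodule.mem_iSup_of_mem 0 (Submodule.mem_span_singleton_self Ω))

/-- The representation is spanned by the vectors `F p₁ ⋯ F pₙ Ω`. -/
theorem eq_top_of_F_mem {N : Submodule ℂ M} (h0 : Ω ∈ N)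
    (hF : ∀ p : A, ∀ v ∈ N, ρ.F p v ∈ N) : N = ⊤ := by
  rw [eq_top_iff, ← hΩ.iSup_lowered_eq_top]
  refine iSup_le fun n => ?_
  induction n with
  | zero => exact (Submodule.span_singleton_le_iff_mem _ _).mpr h0
  | succ n ih => exact lowered_succ_le fun p v hv => hF p v (ih hv)

theorem mem_span_of_weight {v : M} (hv : ρ.H 1 v = D 1 • v) : v ∈ Submodule.span ℂ {Ω} :=
  hΩ.isPrimitive_span.mem_of_H_one (by rw [hΩ.iSup_lowered_eq_top]; trivial) hv

/-- Applying `H g` to `F p Ω = 0` leaves `-2 F (g p) Ω`; hence the annihilator of `Ω` is an ideal.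
-/
theorem F_mul_apply_eq_zero {p : A} (hp : ρ.F p Ω = 0) (g : A) : ρ.F (g * p) Ω = 0 := by
  have h := ρ.H_F g p Ω
  rw [hp, map_zero, hΩ.H_apply, map_smul, hp, smul_zero, zero_sub, eq_comm, neg_eq_zero] at h
  exact (smul_eq_zero.mp h).resolve_left two_ne_zero

/-- The `F q` commute with `F p` and generate everything from `Ω`. The brackets with `E 1` and then
`F 1` extend the vanishing to `H p` and `E p`. -/
theorem F_eq_zero {p : A} (hp : ρ.F p Ω = 0) : ρ.F p = 0 := by
  rw [← LinearMap.ker_eq_top]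
  refine hΩ.eq_top_of_F_mem hp fun q v hv => ?_
  rw [LinearMap.mem_ker] at hv ⊢
  rw [ρ.F_F, hv, map_zero]

theorem H_eq_zero {p : A} (hp : ρ.F p Ω = 0) : ρ.H p = 0 := by
  ext v
  have h := ρ.E_F 1 p v
  simpa [hΩ.F_eq_zero hp] using h.symm

theorem E_eq_zero {p : A} (hp : ρ.F p Ω = 0) : ρ.E p = 0 := by
  ext v
  have h := ρ.H_E p 1 v
  simpa [hΩ.H_eq_zero hp] using h.symm

theorem F_congr {p q : A} (hpq : ρ.F (p - q) Ω = 0) : ρ.F p = ρ.F q := by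
  have h := hΩ.F_eq_zero hpq
  rwa [map_sub, sub_eq_zero] at h

theorem H_congr {p q : A} (hpq : ρ.F (p - q) Ω = 0) : ρ.H p = ρ.H q := by
  have h := hΩ.H_eq_zero hpq
  rwa [map_sub, sub_eq_zero] at h

theorem H_F_triple {l : A} (hl : ρ.IsMinimalIdempotent Ω l) (v : M) :
    ρ.H l (ρ.F l v) = ρ.F l (ρ.H l v) - (2 : ℂ) • ρ.F l v := by
  rw [ρ.H_F, hΩ.F_congr hl.sq]

theorem E_F_triple {l : A} (hl : ρ.IsMinimalIdempotent Ω l) (v : M) :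
    ρ.E l (ρ.F l v) = ρ.F l (ρ.E l v) + ρ.H l v := by
  rw [ρ.E_F, hΩ.H_congr hl.sq]

/-- The Casimir operator of the `sl₂` triple `E l, F l, H l` is a scalar. -/
theorem casimir_apply {l : A} (hl : ρ.IsMinimalIdempotent Ω l) (v : M) :
    ρ.H l (ρ.H l v) + (2 : ℂ) • ρ.H l v + (4 : ℂ) • ρ.F l (ρ.E l v)
      = (D l * (D l + 2)) • v := by
  have key : LinearMap.eqLocus
      (ρ.H l * ρ.H l + (2 : ℂ) • ρ.H l + (4 : ℂ) • (ρ.F l * ρ.E l))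
      ((D l * (D l + 2)) • (1 : End ℂ M)) = ⊤ := by
    refine hΩ.eq_top_of_F_mem ?_ fun p v hv => ?_
    · simp only [LinearMap.mem_eqLocus, LinearMap.add_apply, LinearMap.smul_apply,
        Module.End.mul_apply, Module.End.one_apply, hΩ.E_apply, hΩ.H_apply, map_smul, map_zero]
      module
    · obtain ⟨c, hc⟩ := hl.mul p
      have hF : ∀ w, ρ.F (l * p) w = c • ρ.F l w := fun w => by
        rw [hΩ.F_congr hc, map_smul, LinearMap.smul_apply]
      have hH : ∀ w, ρ.H (l * p) w = c • ρ.H l w := fun w => by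
        rw [hΩ.H_congr hc, map_smul, LinearMap.smul_apply]
      simp only [LinearMap.mem_eqLocus, LinearMap.add_apply, LinearMap.smul_apply,
        Module.End.mul_apply, Module.End.one_apply] at hv ⊢
      rw [← map_smul (ρ.F p), ← hv, ρ.E_F, ρ.H_F, hF, hH, map_add (ρ.F l), map_sub (ρ.H l),
        ρ.H_F, hF, map_smul (ρ.H l), map_smul (ρ.H l), hΩ.H_F_triple hl, ρ.F_F l p]
      simp only [map_add, map_smul]
      module
  have hv : v ∈ (⊤ : Submodule ℂ M) := trivial
  rw [← key] at hv
  simpa using hv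

theorem exists_natCast_eq [FiniteDimensional ℂ M] {l : A} (hl : ρ.IsMinimalIdempotent Ω l) :
    ∃ n : ℕ, D l = n :=
  exists_weight_eq_natCast (hΩ.E_F_triple hl) (hΩ.H_F_triple hl) (hΩ.H_apply l) (hΩ.E_apply l)
    hΩ.ne_zero

/-- On a subspace annihilated by `E l` and invariant under `H l`, the operator `H l` has the same
eigenvalue as on the highest weight vector. -/
theorem H_eq_of_E_eq_zero [FiniteDimensional ℂ M] {l : A} (hl : ρ.IsMinimalIdempotent Ω l)
    {B : Submodule ℂ M} (hE : ∀ v ∈ B, ρ.E l v = 0) (hH : ∀ v ∈ B, ρ.H l v ∈ B) {v : M}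
    (hv : v ∈ B) : ρ.H l v = D l • v := by
  obtain ⟨n, hn⟩ := hΩ.exists_natCast_eq hl
  set w := ρ.H l v - D l • v with hw
  have hwB : w ∈ B := sub_mem (hH v hv) (Submodule.smul_mem _ _ hv)
  have hcas := hΩ.casimir_apply hl v
  rw [hE v hv, map_zero, smul_zero, add_zero] at hcas
  -- Without its `E l` term the Casimir identity factors as `(H l + n + 2)(H l - n) v = 0`. A
  -- nonzero `w` would be primitive of negative weight.
  have hw' : ρ.H l w = (-(n + 2) : ℂ) • w := by
    rw [hw, map_sub, map_smul, eq_sub_of_add_eq hcas, hn]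
    module
  by_contra hne
  obtain ⟨k, hk⟩ := exists_weight_eq_natCast (hΩ.E_F_triple hl) (hΩ.H_F_triple hl) hw'
    (hE w hwB) (sub_ne_zero.mpr hne)
  have : ((k + n + 2 : ℕ) : ℂ) = 0 := by
    push_cast
    linear_combination -hk
  exact absurd this (by exact_mod_cast (Nat.succ_ne_zero (k + n + 1)))

/-- A nonzero invariant subspace contains a nonzero subspace annihilated by all `E p` and invariant
under all `H p`. -/
theorem exists_E_eq_zero {N : Submodule ℂ M} (hN : ρ.Stable N) (hne : N ≠ ⊥) :
    ∃ B ≤ N, B ≠ ⊥ ∧ (∀ p : A, ∀ v ∈ B, ρ.E p v = 0) ∧ ∀ p : A, ∀ v ∈ B, ρ.H p v ∈ B := by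
  classical
  let S := ρ.lowered (Submodule.span ℂ {Ω})
  let T : ℕ → Submodule ℂ M := fun n => ⨆ k : Fin n, S k
  have hmem : ∀ {n k : ℕ}, k < n → S k ≤ T n := fun {n k} hk =>
    le_iSup (fun k : Fin n => S k) ⟨k, hk⟩
  have hmono : Monotone T := fun m n hmn => iSup_le fun k => hmem (k.2.trans_le hmn)
  have htop : ⨆ n, T n = ⊤ := by
    rw [eq_top_iff, ← hΩ.iSup_lowered_eq_top]
    exact iSup_le fun n => (hmem n.lt_succ_self).trans (le_iSup T (n + 1))
  have hET : ∀ (p : A) (n : ℕ), ∀ v ∈ T (n + 1), ρ.E p v ∈ T n := by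
    intro p n v hv
    refine (iSup_le fun k => ?_ : T (n + 1) ≤ (T n).comap (ρ.E p)) hv
    rintro w hw
    rw [Submodule.mem_comap]
    obtain ⟨k, hk⟩ := k
    cases k with
    | zero => rw [hΩ.isPrimitive_span.E_eq_zero p hw]; exact zero_mem _
    | succ k => exact hmem (by omega) (hΩ.isPrimitive_span.E_mem_lowered p hw)
  have hHT : ∀ (p : A) (n : ℕ), ∀ v ∈ T n, ρ.H p v ∈ T n := by
    intro p n v hv
    refine (iSup_le fun k => ?_ : T n ≤ (T n).comap (ρ.H p)) hv
    exact fun w hw => hmem k.2 (hΩ.isPrimitive_span.H_mem_lowered p hw)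
  have hex : ∃ n, N ⊓ T n ≠ ⊥ := by
    obtain ⟨v, hv, hv0⟩ := N.ne_bot_iff.mp hne
    have hvT : v ∈ ⨆ n, T n := by rw [htop]; trivial
    obtain ⟨n, hn⟩ := (Submodule.mem_iSup_of_directed T hmono.directed_le).mp hvT
    exact ⟨n, (Submodule.ne_bot_iff _).mpr ⟨v, ⟨hv, hn⟩, hv0⟩⟩
  -- At the first level of the filtration `T` that meets `N`, every `E p` drops into the previous
  -- level, where the intersection is zero.
  obtain ⟨n, hn⟩ : ∃ n, Nat.find hex = n + 1 := by
    refine Nat.exists_eq_succ_of_ne_zero fun h0 => Nat.find_spec hex ?_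
    rw [h0, eq_bot_iff]
    exact inf_le_right.trans (iSup_le fun k => k.elim0)
  have h1 := Nat.find_spec hex
  have h2 : N ⊓ T n = ⊥ := not_not.mp (Nat.find_min hex (m := n) (by omega))
  rw [hn] at h1
  refine ⟨N ⊓ T (n + 1), inf_le_left, h1, fun p v hv => ?_, fun p v hv =>
    ⟨hN.H_mem p hv.1, hHT p _ v hv.2⟩⟩
  rw [← Submodule.mem_bot ℂ, ← h2]
  exact ⟨hN.E_mem p hv.1, hET p n v hv.2⟩

/-- If the identity is a sum of minimal idempotents modulo the kernel of the representation, the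
representation is irreducible. -/
theorem irred_of_sum_eq_one [FiniteDimensional ℂ M] {ι : Type*} [Fintype ι] {l : ι → A}
    (hl : ∀ i, ρ.IsMinimalIdempotent Ω (l i)) (hsum : ρ.F (∑ i, l i - 1) Ω = 0) : ρ.Irred := by
  intro N hN hne
  obtain ⟨B, hBN, hB0, hE, hH⟩ := hΩ.exists_E_eq_zero hN hne
  obtain ⟨v, hv, hv0⟩ := B.ne_bot_iff.mp hB0
  have hone : ∀ w, (∀ i, ρ.H (l i) w = D (l i) • w) → ρ.H 1 w = (∑ i, D (l i)) • w := by
    intro w hw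
    rw [← hΩ.H_congr hsum, map_sum, LinearMap.sum_apply, Finset.sum_smul]
    exact Finset.sum_congr rfl fun i _ => hw i
  have hD : D 1 = ∑ i, D (l i) := by
    refine smul_left_injective ℂ hΩ.ne_zero ?_
    simp only [← hΩ.H_apply 1]
    exact hone Ω fun i => hΩ.H_apply _
  have hv1 : v ∈ Submodule.span ℂ {Ω} := by
    refine hΩ.mem_span_of_weight ?_
    rw [hD]
    exact hone v fun i => hΩ.H_eq_of_E_eq_zero (hl i) (hE _) (hH _) hv
  obtain ⟨c, rfl⟩ := Submodule.mem_span_singleton.mp hv1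
  have hc : c ≠ 0 := fun h => hv0 (by rw [h, zero_smul])
  exact hΩ.generates N hN ((Submodule.smul_mem_iff _ hc).mp (hBN hv))

end IsHighest
end CurrentRep

/-! ### Divided powers -/

section DividedPower

variable {M : Type*} [AddCommGroup M] [Module ℂ M]

/-- The divided power `xⁿ / n!` of an operator. -/
noncomputable def dividedPower (x : End ℂ M) (n : ℕ) : End ℂ M := ((n.factorial : ℂ)⁻¹) • x ^ n

theorem dividedPower_apply (x : End ℂ M) (n : ℕ) (v : M) :
    dividedPower x n v = ((n.factorial : ℂ)⁻¹) • (x ^ n) v := rfl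

theorem commute_dividedPower {x y : End ℂ M} (h : Commute x y) (m n : ℕ) :
    Commute (dividedPower x m) (dividedPower y n) :=
  ((h.pow_pow m n).smul_left _).smul_right _

theorem dividedPower_add {x y : End ℂ M} (h : Commute x y) (n : ℕ) :
    dividedPower (x + y) n =
      ∑ ij ∈ Finset.HasAntidiagonal.antidiagonal n, dividedPower x ij.1 * dividedPower y ij.2 := by
  rw [dividedPower, h.add_pow', Finset.smul_sum]
  refine Finset.sum_congr rfl fun ij hij => ?_
  rw [Finset.HasAntidiagonal.mem_antidiagonal] at hij
  rw [dividedPower, dividedPower, smul_mul_smul_comm, ← Nat.cast_smul_eq_nsmul ℂ, smul_smul]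
  congr 1
  have h1 := Nat.add_choose_mul_factorial_mul_factorial ij.2 ij.1
  rw [add_comm, hij, mul_right_comm] at h1
  have h2 : ((n.choose ij.1 : ℕ) : ℂ) * ij.1.factorial * ij.2.factorial = n.factorial := by
    exact_mod_cast h1
  have h3 : (ij.1.factorial : ℂ) ≠ 0 := by exact_mod_cast ij.1.factorial_ne_zero
  have h4 : (ij.2.factorial : ℂ) ≠ 0 := by exact_mod_cast ij.2.factorial_ne_zero
  have h5 : (n.factorial : ℂ) ≠ 0 := by exact_mod_cast n.factorial_ne_zero
  field_simp
  linear_combination h2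

end DividedPower

/-! ### Irreducible representations: radical kernel and roots of the Drinfeld polynomial -/

namespace CurrentRep

variable {A M : Type*} [CommRing A] [Algebra ℂ A] [AddCommGroup M] [Module ℂ M]
  {ρ : CurrentRep A M}

theorem commute_E (p q : A) : Commute (ρ.E p) (ρ.E q) := LinearMap.ext (ρ.E_E p q)

theorem commute_F (p q : A) : Commute (ρ.F p) (ρ.F q) := LinearMap.ext (ρ.F_F p q)

theorem IsPrimitive.pow_E_mem {B : Submodule ℂ M} {μ : ℂ} (hB : ρ.IsPrimitive B μ) (p : A)
    {n : ℕ} {v : M} (hv : v ∈ ρ.lowered B n) : (ρ.E p ^ n) v ∈ B := by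
  induction n generalizing v with
  | zero => exact hv
  | succ n ih =>
    rw [pow_succ, Module.End.mul_apply]
    exact ih (hB.E_mem_lowered p hv)

theorem IsPrimitive.pow_E_eq_zero {B : Submodule ℂ M} {μ : ℂ} (hB : ρ.IsPrimitive B μ) (p : A)
    {m n : ℕ} (hmn : n < m) {v : M} (hv : v ∈ ρ.lowered B n) : (ρ.E p ^ m) v = 0 := by
  obtain ⟨k, rfl⟩ := Nat.exists_eq_add_of_lt hmn
  rw [show n + k + 1 = k + 1 + n by ring, pow_add, pow_succ, Module.End.mul_apply,
    Module.End.mul_apply, hB.E_eq_zero p (hB.pow_E_mem p hv), map_zero]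

namespace IsHighest

variable {Ω : M} {D : A → ℂ} (hΩ : ρ.IsHighest Ω D)
include hΩ

theorem exists_dividedPower_apply (p q : A) (n : ℕ) :
    ∃ c : ℂ, dividedPower (ρ.E p) n (dividedPower (ρ.F q) n Ω) = c • Ω := by
  have h := hΩ.isPrimitive_span.pow_E_mem p
    (pow_F_mem_lowered q (Submodule.mem_span_singleton_self Ω) n)
  obtain ⟨c, hc⟩ := Submodule.mem_span_singleton.mp h
  refine ⟨(n.factorial : ℂ)⁻¹ * ((n.factorial : ℂ)⁻¹ * c), ?_⟩
  rw [dividedPower_apply, dividedPower_apply, map_smul, ← hc, smul_smul, smul_smul, mul_assoc]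

theorem dividedPower_apply_eq_zero (p q : A) {m n : ℕ} (hmn : n < m) :
    dividedPower (ρ.E p) m (dividedPower (ρ.F q) n Ω) = 0 := by
  rw [dividedPower_apply, dividedPower_apply, map_smul, hΩ.isPrimitive_span.pow_E_eq_zero p hmn
    (pow_F_mem_lowered q (Submodule.mem_span_singleton_self Ω) n), smul_zero, smul_zero]

theorem exists_natCast_eq_one [FiniteDimensional ℂ M] : ∃ n : ℕ, D 1 = n :=
  exists_weight_eq_natCast (e := ρ.E 1) (f := ρ.F 1) (h := ρ.H 1)
    (fun v => by simpa using ρ.E_F 1 1 v) (fun v => by simpa using ρ.H_F 1 1 v)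
    (hΩ.H_apply 1) (hΩ.E_apply 1) hΩ.ne_zero

theorem exists_pow_F_eq_zero [FiniteDimensional ℂ M] (p : A) : ∃ n : ℕ, (ρ.F p ^ n) Ω = 0 :=
  exists_pow_apply_eq_zero (h := ρ.H 1) (fun v => by simpa using ρ.H_F 1 p v) (hΩ.H_apply 1)

/-- In an irreducible representation there is no primitive vector one step below the highest
weight. -/
theorem eq_zero_of_irred (hirr : ρ.Irred) {v : M} (hE : ∀ p, ρ.E p v = 0)
    (hH : ρ.H 1 v = (D 1 - 2) • v) : v = 0 := by
  let B : Submodule ℂ M := (⨅ p, LinearMap.ker (ρ.E p)) ⊓ (ρ.H 1).eigenspace (D 1 - 2)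
  have hmem : ∀ w, w ∈ B ↔ (∀ p, ρ.E p w = 0) ∧ ρ.H 1 w = (D 1 - 2) • w := fun w => by
    rw [Submodule.mem_inf, Submodule.mem_iInf, Module.End.mem_eigenspace_iff]
    rfl
  have hB : ρ.IsPrimitive B (D 1 - 2) := by
    refine ⟨fun p w hw => ((hmem w).mp hw).1 p, fun p w hw => ?_, fun hw => ((hmem _).mp hw).2⟩
    obtain ⟨h1, h2⟩ := (hmem w).mp hw
    refine (hmem _).mpr ⟨fun q => ?_, by rw [ρ.H_H, h2, map_smul]⟩
    have h := ρ.H_E p q w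
    rw [h1, h1, map_zero, smul_zero, add_zero] at h
    exact h.symm
  by_contra hv
  have hvB : v ∈ ⨆ n, ρ.lowered B n := Submodule.mem_iSup_of_mem 0 ((hmem v).mpr ⟨hE, hH⟩)
  have htop := hirr _ hB.stable_iSup_lowered ((Submodule.ne_bot_iff _).mpr ⟨v, hvB, hv⟩)
  -- The invariant subspace generated by `B` has only the weights `D 1 - 2 - 2n`, so it misses `Ω`.
  have hd := hB.disjoint_lowered_eigenspace (ν := D 1) (k := 0) fun n h => by
    have : ((n + 1 : ℕ) : ℂ) = 0 := by
      push_cast at h ⊢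
      linear_combination (-1 / 2 : ℂ) * h
    exact absurd this (by exact_mod_cast n.succ_ne_zero)
  refine hΩ.ne_zero (Submodule.disjoint_def.mp hd Ω
    (Module.End.mem_eigenspace_iff.mpr (hΩ.H_apply 1)) ?_)
  exact htop ▸ Submodule.mem_top

/-- Since `E g (F p Ω) = D (g p) Ω = 0`, the vector `F p Ω` is primitive one step below the top. -/
theorem F_apply_eq_zero_of_irred (hirr : ρ.Irred) {p : A} (hp : ∀ g, D (g * p) = 0) :
    ρ.F p Ω = 0 := by
  refine hΩ.eq_zero_of_irred hirr (fun g => ?_) ?_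
  · rw [ρ.E_F, hΩ.E_apply, map_zero, zero_add, hΩ.H_apply, hp, zero_smul]
  · rw [ρ.H_F, hΩ.H_apply, map_smul, one_mul, sub_smul]

/-- Here `H p` commutes with `F p`, so `E 1` acts on powers of `F p` like a derivative, with factor
`(n + 1) D p`. Nilpotency of `F p` on `Ω` then forces `D p = 0`. -/
theorem eq_zero_of_F_sq [FiniteDimensional ℂ M] {p : A} (hp : ρ.F (p * p) Ω = 0) : D p = 0 := by
  classical
  have hH : ∀ n : ℕ, ρ.H p ((ρ.F p ^ n) Ω) = D p • (ρ.F p ^ n) Ω := by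
    intro n
    induction n with
    | zero => exact hΩ.H_apply p
    | succ n ih =>
      rw [pow_succ', Module.End.mul_apply, ρ.H_F, ih, hΩ.F_eq_zero hp, LinearMap.zero_apply,
        smul_zero, sub_zero, map_smul]
  have hE : ∀ n : ℕ, ρ.E 1 ((ρ.F p ^ (n + 1)) Ω) = ((n + 1) * D p) • (ρ.F p ^ n) Ω := by
    intro n
    induction n with
    | zero => simp [ρ.E_F, hΩ.E_apply, hΩ.H_apply]
    | succ n ih =>
      rw [pow_succ', Module.End.mul_apply, ρ.E_F, ih, one_mul, hH, map_smul,
        ← Module.End.mul_apply, ← pow_succ', ← add_smul]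
      congr 1
      push_cast
      ring
  have hex := hΩ.exists_pow_F_eq_zero p
  obtain ⟨n, hn⟩ : ∃ n, Nat.find hex = n + 1 := by
    refine Nat.exists_eq_succ_of_ne_zero fun h0 => hΩ.ne_zero ?_
    simpa [h0] using Nat.find_spec hex
  have h1 := Nat.find_spec hex
  have h2 := Nat.find_min hex (m := n) (by omega)
  have h3 := hE n
  rw [← hn, h1, map_zero, eq_comm, smul_eq_zero, or_iff_left h2, mul_eq_zero,
    or_iff_right (by exact_mod_cast n.succ_ne_zero)] at h3
  exact h3

/-- The kernel of a finite-dimensional irreducible highest weight representation is a radical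
ideal. -/
theorem F_apply_eq_zero_of_sq [FiniteDimensional ℂ M] (hirr : ρ.Irred) {p : A}
    (hp : ρ.F (p * p) Ω = 0) : ρ.F p Ω = 0 := by
  refine hΩ.F_apply_eq_zero_of_irred hirr fun g => hΩ.eq_zero_of_F_sq ?_
  rw [show g * p * (g * p) = g * g * (p * p) by ring]
  exact hΩ.F_mul_apply_eq_zero hp _

theorem weight_ne_zero_of_irred (hirr : ρ.Irred) {l : A} (hl : ρ.IsMinimalIdempotent Ω l)
    (hne : ρ.F l Ω ≠ 0) : D l ≠ 0 := by
  refine fun h0 => hne (hΩ.F_apply_eq_zero_of_irred hirr fun g => ?_)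
  obtain ⟨c, hc⟩ := hl.mul g
  have h := hΩ.H_apply (g * l)
  rw [mul_comm, hΩ.H_congr hc, map_smul, LinearMap.smul_apply, hΩ.H_apply, h0, zero_smul,
    smul_zero, eq_comm, smul_eq_zero, or_iff_left hΩ.ne_zero] at h
  rwa [mul_comm]

theorem commute_E_F {p q : A} (hpq : ρ.F (p * q) Ω = 0) : Commute (ρ.E p) (ρ.F q) :=
  LinearMap.ext fun v => by
    simpa [hΩ.H_eq_zero hpq] using ρ.E_F p q v

/-- Splitting off the factor of the generating function of the eigenvalues that belongs to a
minimal idempotent `l` on which `t` acts as the scalar `b`. -/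
theorem dividedPower_apply_eq_sum {l t : A} (hl : ρ.IsMinimalIdempotent Ω l) {b : ℂ}
    (htl : ρ.F (t * l - b • l) Ω = 0) {n : ℕ} (hn : D l = n) {lam' : ℕ → ℂ}
    (hlam' : ∀ j, dividedPower (ρ.E (1 - l)) j (dividedPower (ρ.F (t * (1 - l))) j Ω)
      = lam' j • Ω) (j : ℕ) :
    dividedPower (ρ.E 1) j (dividedPower (ρ.F t) j Ω) =
      (∑ ij ∈ Finset.HasAntidiagonal.antidiagonal j, b ^ ij.1 * n.choose ij.1 * lam' ij.2) • Ω := by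
  have hE : ρ.E 1 = ρ.E l + ρ.E (1 - l) := by rw [← map_add]; congr 1; ring
  have hF : ρ.F t = ρ.F (t * l) + ρ.F (t * (1 - l)) := by rw [← map_add]; congr 1; ring
  have hz : ∀ g : A, ρ.F (g * (l * l - l)) Ω = 0 := hΩ.F_mul_apply_eq_zero hl.sq
  -- Modulo the kernel `l` and `1 - l` are orthogonal, so their two triples commute.
  have hc12 : Commute (ρ.E l) (ρ.F (t * (1 - l))) := hΩ.commute_E_F <| by
    rw [show l * (t * (1 - l)) = -t * (l * l - l) by ring]; exact hz _
  have hc21 : Commute (ρ.E (1 - l)) (ρ.F (t * l)) := hΩ.commute_E_F <| by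
    rw [show (1 - l) * (t * l) = -t * (l * l - l) by ring]; exact hz _
  have hdiag : ∀ k, dividedPower (ρ.E l) k (dividedPower (ρ.F (t * l)) k Ω)
      = (b ^ k * n.choose k) • Ω := by
    intro k
    have hk : (k.factorial : ℂ) ≠ 0 := by exact_mod_cast k.factorial_ne_zero
    rw [hΩ.F_congr htl, map_smul, dividedPower_apply, dividedPower_apply, smul_pow,
      LinearMap.smul_apply, map_smul, map_smul, raise_pow_lower_pow_apply (hΩ.E_F_triple hl)
      (hΩ.H_F_triple hl) (by rw [hΩ.H_apply, hn]) (hΩ.E_apply l), smul_smul, smul_smul, smul_smul]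
    congr 1
    field_simp
  rw [hE, hF, dividedPower_add (commute_E _ _), dividedPower_add (commute_F _ _),
    LinearMap.sum_apply, Finset.sum_smul]
  refine Finset.sum_congr rfl fun ij hij => ?_
  rw [LinearMap.sum_apply, map_sum, Finset.sum_eq_single ij]
  · rw [← Module.End.mul_apply, (commute_dividedPower hc21 _ _).mul_mul_mul_comm,
      Module.End.mul_apply, Module.End.mul_apply (dividedPower (ρ.E (1 - l)) _), hlam', map_smul,
      Module.End.mul_apply, hdiag, smul_smul, mul_comm (lam' _)]
  -- Off the diagonal, one of the two commuting factors has more raising than lowering operators and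
  -- kills `Ω`.
  · intro kl hkl hne
    rw [Finset.HasAntidiagonal.mem_antidiagonal] at hij hkl
    rw [← Module.End.mul_apply, (commute_dividedPower hc21 _ _).mul_mul_mul_comm]
    rcases lt_or_ge kl.1 ij.1 with hlt | hge
    · rw [(((commute_dividedPower (commute_E _ _) _ _).mul_right
        (commute_dividedPower hc12 _ _)).mul_left
        ((commute_dividedPower hc21.symm _ _).mul_right
        (commute_dividedPower (commute_F _ _) _ _))).eq, Module.End.mul_apply,
        Module.End.mul_apply (dividedPower (ρ.E l) _), hΩ.dividedPower_apply_eq_zero _ _ hlt,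
        map_zero]
    · have hlt : kl.2 < ij.2 := by
        have : kl.1 ≠ ij.1 := fun h => hne (Prod.ext h (by omega))
        omega
      rw [Module.End.mul_apply, Module.End.mul_apply (dividedPower (ρ.E (1 - l)) _),
        hΩ.dividedPower_apply_eq_zero _ _ hlt, map_zero]
  · exact fun h => absurd hij h

/-- If `t` acts as the scalar `b` on a minimal idempotent, then `1 / b` is a root of the Drinfeld
polynomial. -/
theorem sum_eigenvalues_eq_zero [FiniteDimensional ℂ M] (hirr : ρ.Irred) {l t t' : A}
    (hl : ρ.IsMinimalIdempotent Ω l) (hne : ρ.F l Ω ≠ 0) (ht : t' * t = 1) {b : ℂ} (hb : b ≠ 0)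
    (htl : ρ.F (t * l - b • l) Ω = 0) {r : ℕ} (hr : D 1 = r) {lam : ℕ → ℂ}
    (hlam : ∀ j ≤ r, dividedPower (ρ.E 1) j (dividedPower (ρ.F t) j Ω) = lam j • Ω) :
    ∑ j ∈ Finset.range (r + 1), lam j * (-b⁻¹) ^ j = 0 := by
  obtain ⟨n, hn⟩ := hΩ.exists_natCast_eq hl
  have hn0 : n ≠ 0 := fun h =>
    hΩ.weight_ne_zero_of_irred hirr hl hne (by rw [hn, h, Nat.cast_zero])
  choose lam' hlam' using hΩ.exists_dividedPower_apply (1 - l) (t * (1 - l))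
  obtain ⟨K, hK⟩ := hΩ.exists_pow_F_eq_zero (t * (1 - l))
  have hsmul : Function.Injective fun c : ℂ => c • Ω := smul_left_injective ℂ hΩ.ne_zero
  have hK' : ∀ j, K ≤ j → lam' j = 0 := by
    intro j hj
    refine hsmul ?_
    obtain ⟨i, rfl⟩ := Nat.exists_eq_add_of_le hj
    simp only [← hlam', dividedPower_apply, add_comm K i, pow_add _ i K, Module.End.mul_apply, hK,
      map_zero, smul_zero, zero_smul]
  -- The generating function of the eigenvalues. Truncating at `K` loses nothing, since `F (t * (1 -
  -- l))` is nilpotent on `Ω`.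
  let Q : Polynomial ℂ := (1 + Polynomial.C b * Polynomial.X) ^ n *
    ∑ k ∈ Finset.range K, Polynomial.monomial k (lam' k)
  have hQ : ∀ j, dividedPower (ρ.E 1) j (dividedPower (ρ.F t) j Ω) = Q.coeff j • Ω := by
    intro j
    rw [hΩ.dividedPower_apply_eq_sum hl htl hn hlam', Polynomial.coeff_mul]
    congr 1
    refine Finset.sum_congr rfl fun ij _ => ?_
    congr 1
    · have hcomp : (1 + Polynomial.C b * Polynomial.X) ^ n =
          ((1 + Polynomial.X : Polynomial ℂ) ^ n).comp (Polynomial.C b * Polynomial.X) := by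
        simp
      rw [hcomp, Polynomial.comp_C_mul_X_coeff, Polynomial.coeff_one_add_X_pow, mul_comm]
    · rw [Polynomial.finsetSum_coeff]
      simp only [Polynomial.coeff_monomial, Finset.sum_ite_eq', Finset.mem_range]
      split_ifs with h
      · rfl
      · exact hK' _ (not_lt.mp h)
  have hdeg : Q.natDegree < r + 1 := by
    rw [Nat.lt_succ_iff, Polynomial.natDegree_le_iff_coeff_eq_zero]
    intro j hj
    refine hsmul ?_
    -- As `t' * t = 1`, the operators `E t'`, `F t`, `H 1` form an `sl₂` triple, for which `Ω` has
    -- weight `r`.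
    have hz : (ρ.F t ^ (r + 1)) Ω = 0 :=
      pow_succ_apply_eq_zero (e := ρ.E t') (h := ρ.H 1)
        (fun v => by rw [ρ.E_F, ht]) (fun v => by rw [ρ.H_F, one_mul])
        (by rw [hΩ.H_apply, hr]) (hΩ.E_apply t')
    obtain ⟨i, rfl⟩ := Nat.exists_eq_add_of_lt hj
    simp only [← hQ, dividedPower_apply, show r + i + 1 = i + (r + 1) by ring,
      pow_add _ i (r + 1), Module.End.mul_apply, hz, map_zero, smul_zero, zero_smul]
  have heval : Q.eval (-b⁻¹) = 0 := by
    simp [Q, hb, hn0]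
  rw [Polynomial.eval_eq_sum_range' hdeg] at heval
  refine Eq.trans (Finset.sum_congr rfl fun j hj => ?_) heval
  congr 1
  refine hsmul ?_
  simp only [← hQ, hlam j (Finset.mem_range_succ_iff.mp hj)]

end IsHighest
end CurrentRep

/-! ### Laurent polynomials: the generator of the kernel ideal -/

namespace CurrentRep

open Polynomial
open LaurentPolynomial hiding C smul_eq_C_mul

variable {M : Type*} [AddCommGroup M] [Module ℂ M] {ρ : CurrentRep ℂ[T;T⁻¹] M}

namespace IsHighest

variable {Ω : M} {D : ℂ[T;T⁻¹] → ℂ} (hΩ : ρ.IsHighest Ω D)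
include hΩ

/-- The polynomials that act as zero. -/
def polyKernel : Ideal ℂ[X] where
  carrier := {p | ρ.F (toLaurentAlg p) Ω = 0}
  zero_mem' := by simp
  add_mem' {p q} hp hq := by
    simp only [Set.mem_ofPred_eq, map_add, LinearMap.add_apply] at hp hq ⊢
    rw [hp, hq, add_zero]
  smul_mem' g p hp := by
    simp only [Set.mem_ofPred_eq, smul_eq_mul, map_mul] at hp ⊢
    exact hΩ.F_mul_apply_eq_zero hp _

theorem mem_polyKernel {p : ℂ[X]} : p ∈ hΩ.polyKernel ↔ ρ.F (toLaurentAlg p) Ω = 0 := Iff.rfl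

theorem mem_polyKernel_of_X_mul {p : ℂ[X]} (hp : X * p ∈ hΩ.polyKernel) : p ∈ hΩ.polyKernel := by
  have h := hΩ.F_mul_apply_eq_zero (hΩ.mem_polyKernel.mp hp) (T (-1))
  rw [map_mul toLaurentAlg, ← mul_assoc, toLaurentAlg_apply X, toLaurent_X, ← T_add,
    neg_add_cancel, T_zero, one_mul] at h
  exact h

theorem polyKernel_ne_bot [FiniteDimensional ℂ M] : hΩ.polyKernel ≠ ⊥ := by
  intro hbot
  let g : ℂ[X] →ₗ[ℂ] M :=
    LinearMap.applyₗ Ω ∘ₗ ρ.F ∘ₗ (toLaurentAlg (R := ℂ)).toLinearMap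
  have hg : Function.Injective g := by
    rw [← LinearMap.ker_eq_bot, LinearMap.ker_eq_bot']
    intro p hp
    rw [← Ideal.mem_bot, ← hbot]
    exact hp
  have := Module.Finite.of_injective g hg
  exact Polynomial.not_finite this

theorem F_T_mul_sub {l : ℂ[X]} {b : ℂ} (hl : (X - C b) * l ∈ hΩ.polyKernel) :
    ρ.F (T 1 * toLaurentAlg l - b • toLaurentAlg l) Ω = 0 := by
  rw [mem_polyKernel, sub_mul, ← smul_eq_C_mul, map_sub, map_mul, map_smul, toLaurentAlg_apply X,
    toLaurent_X] at hl
  exact hl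

/-- Modulo `X - b` a polynomial is its value at `b`, so `l * p` acts as `p(b) l`. Dividing by `T`
divides this scalar by `b`, which covers Laurent polynomials. -/
theorem isMinimalIdempotent {l : ℂ[X]} {b : ℂ} (hb : b ≠ 0)
    (hl : (X - C b) * l ∈ hΩ.polyKernel) (hlb : l.eval b = 1) :
    ρ.IsMinimalIdempotent Ω (toLaurentAlg l) := by
  have hpoly : ∀ p : ℂ[X], ρ.F (toLaurentAlg l * toLaurentAlg p - p.eval b • toLaurentAlg l) Ω
      = 0 := by
    intro p
    obtain ⟨g, hg⟩ := X_sub_C_dvd_sub_C_eval (p := p) (a := b)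
    have h := hΩ.polyKernel.mul_mem_left g hl
    rw [← mul_assoc, mul_comm g, ← hg, sub_mul, ← smul_eq_C_mul, mem_polyKernel, map_sub, map_mul,
      map_smul, mul_comm] at h
    exact h
  refine ⟨by simpa [hlb] using hpoly l, fun p => ?_⟩
  refine reduce_to_polynomial_of_mul_T p
    (Q := fun p => ∃ c : ℂ, ρ.F (toLaurentAlg l * p - c • toLaurentAlg l) Ω = 0)
    (fun p => ⟨p.eval b, hpoly p⟩) ?_
  rintro p ⟨c, hc⟩
  refine ⟨c / b, ?_⟩
  have h1 := hΩ.F_mul_apply_eq_zero hc (T (-1))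
  have h2 := hΩ.F_mul_apply_eq_zero (hΩ.F_T_mul_sub hl) (T (-1))
  have hT : (T (-1) * T 1 : ℂ[T;T⁻¹]) = 1 := by rw [← T_add]; simp
  have hsplit : toLaurentAlg l * p - (c / b) • toLaurentAlg l =
      T (-1) * (toLaurentAlg l * (p * T 1) - c • toLaurentAlg l) -
        (c / b) • (T (-1) * (T 1 * toLaurentAlg l - b • toLaurentAlg l)) := by
    have e1 : T (-1) * (toLaurentAlg l * (p * T 1) - c • toLaurentAlg l) =
        toLaurentAlg l * p - c • (T (-1) * toLaurentAlg l) := by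
      rw [mul_sub, mul_smul_comm]
      congr 1
      linear_combination (toLaurentAlg l * p) * hT
    have e2 : T (-1) * (T 1 * toLaurentAlg l - b • toLaurentAlg l) =
        toLaurentAlg l - b • (T (-1) * toLaurentAlg l) := by
      rw [mul_sub, mul_smul_comm, ← mul_assoc, hT, one_mul]
    rw [e1, e2, smul_sub, smul_smul, div_mul_cancel₀ c hb]
    abel
  rw [hsplit, map_sub, map_smul, LinearMap.sub_apply, LinearMap.smul_apply, h1, h2, smul_zero,
    sub_zero]

theorem irred_of_F_prod_eq_zero [FiniteDimensional ℂ M] {ι : Type*} [Fintype ι] {a : ι → ℂ}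
    (hinj : Function.Injective a) (ha : ∀ i, a i ≠ 0)
    (hF : ρ.F (toLaurentAlg (∏ i, (X - C (a i)))) Ω = 0) : ρ.Irred := by
  classical
  have hmem : ∀ p : ℂ[X], (∀ i, p.eval (a i) = 0) → p ∈ hΩ.polyKernel := by
    intro p hp
    obtain ⟨g, rfl⟩ : ∏ i, (X - C (a i)) ∣ p := by
      refine Finset.prod_dvd_of_coprime (fun i _ j _ hij => ?_) fun i _ => dvd_iff_isRoot.mpr (hp i)
      exact pairwise_coprime_X_sub_C hinj hij
    rw [mul_comm]
    exact hΩ.polyKernel.mul_mem_left g hF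
  let l : ι → ℂ[X] := fun i => Lagrange.basis Finset.univ a i
  have hself : ∀ i, (l i).eval (a i) = 1 := fun i =>
    Lagrange.eval_basis_self hinj.injOn (Finset.mem_univ i)
  have hother : ∀ i j, i ≠ j → (l i).eval (a j) = 0 := fun i j hij =>
    Lagrange.eval_basis_of_ne hij (Finset.mem_univ j)
  refine hΩ.irred_of_sum_eq_one (l := fun i => toLaurentAlg (l i)) (fun i => ?_) ?_
  · refine hΩ.isMinimalIdempotent (ha i) (hmem _ fun j => ?_) (hself i)
    rcases eq_or_ne i j with rfl | hij
    · simp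
    · simp [hother i j hij]
  · rw [← map_sum, ← map_one (toLaurentAlg (R := ℂ)), ← map_sub]
    refine hmem _ fun j => ?_
    rw [eval_sub, eval_finsetSum, Finset.sum_eq_single j (fun i _ hij => hother i j hij) (by simp),
      hself, eval_one, sub_self]

theorem F_prod_eq_zero_of_irred [FiniteDimensional ℂ M] (hirr : ρ.Irred) {ι : Type*} [Fintype ι]
    {a : ι → ℂ} {r : ℕ} (hr : D 1 = r) {lam : ℕ → ℂ}
    (hlam : ∀ j ≤ r, dividedPower (ρ.E 1) j (dividedPower (ρ.F (T 1)) j Ω) = lam j • Ω)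
    (ha : ∀ b : ℂ, b ≠ 0 → ∑ j ∈ Finset.range (r + 1), lam j * (-b⁻¹) ^ j = 0 → ∃ i, a i = b) :
    ρ.F (toLaurentAlg (∏ i, (X - C (a i)))) Ω = 0 := by
  classical
  obtain ⟨q, hq⟩ := (IsPrincipalIdealRing.principal hΩ.polyKernel).principal
  have hmem : ∀ p, p ∈ hΩ.polyKernel ↔ q ∣ p := fun p => by
    rw [hq]; exact Ideal.mem_span_singleton
  have hq0 : q ≠ 0 := by
    rintro rfl
    exact hΩ.polyKernel_ne_bot (by rw [hq]; simp)
  -- A proper factor of the generator has smaller degree, so it is not in the ideal.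
  have hfactor : ∀ (b : ℂ) (q₁ : ℂ[X]), q = (X - C b) * q₁ → q₁ ∉ hΩ.polyKernel := by
    intro b q₁ h hmem'
    have hq₁ : q₁ ≠ 0 := by rintro rfl; simp [h] at hq0
    have hd := natDegree_le_of_dvd ((hmem q₁).mp hmem') hq₁
    rw [h, natDegree_mul (X_sub_C_ne_zero b) hq₁, natDegree_X_sub_C] at hd
    omega
  -- If `b` were a double root, `q` would divide `q₁ ^ 2`, and radicality would put `q₁` in the
  -- ideal.
  have hsimple : ∀ (b : ℂ) (q₁ : ℂ[X]), q = (X - C b) * q₁ → q₁.eval b ≠ 0 := by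
    intro b q₁ h h0
    obtain ⟨q₂, hq₂⟩ := dvd_iff_isRoot.mpr h0
    refine hfactor b q₁ h (hΩ.F_apply_eq_zero_of_sq hirr ?_)
    rw [← map_mul, ← hΩ.mem_polyKernel, hmem]
    exact ⟨q₂, by rw [h]; linear_combination q₁ * hq₂⟩
  have hroot : ∀ b, q.IsRoot b → ∃ i, a i = b := by
    intro b hb
    obtain ⟨q₁, hq₁⟩ := dvd_iff_isRoot.mpr hb
    have hb0 : b ≠ 0 := by
      rintro rfl
      refine hfactor 0 q₁ hq₁ (hΩ.mem_polyKernel_of_X_mul ((hmem _).mpr ?_))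
      rw [hq₁, C_0, sub_zero]
    have he := hsimple b q₁ hq₁
    -- The idempotent at the root `b` is `q₁` scaled to take the value `1` there.
    have hl : (X - C b) * (C (q₁.eval b)⁻¹ * q₁) ∈ hΩ.polyKernel :=
      (hmem _).mpr ⟨C (q₁.eval b)⁻¹, by rw [hq₁]; ring⟩
    refine ha b hb0 (hΩ.sum_eigenvalues_eq_zero hirr (t' := T (-1))
      (hΩ.isMinimalIdempotent hb0 hl (by simp [he])) ?_ (by rw [← T_add]; simp) hb0
      (hΩ.F_T_mul_sub hl) hr hlam)
    rw [← smul_eq_C_mul, map_smul, map_smul, LinearMap.smul_apply]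
    exact smul_ne_zero (inv_ne_zero he) (hfactor b q₁ hq₁)
  have hprod : ∏ i, (X - C (a i)) ≠ 0 :=
    Finset.prod_ne_zero_iff.mpr fun i _ => X_sub_C_ne_zero (a i)
  rw [← hΩ.mem_polyKernel, hmem, IsAlgClosed.dvd_iff_roots_le_roots hq0 hprod]
  have hnodup : q.roots.Nodup := by
    rw [Multiset.nodup_iff_count_le_one]
    intro b
    by_contra! hlt
    rw [count_roots] at hlt
    have h2 : (X - C b) ^ 2 ∣ q := (le_rootMultiplicity_iff hq0).mp hlt
    obtain ⟨q₂, hq₂⟩ := h2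
    exact hsimple b ((X - C b) * q₂) (by rw [hq₂]; ring) (by simp)
  rw [Multiset.le_iff_subset hnodup]
  intro b hb
  obtain ⟨i, rfl⟩ := hroot b (isRoot_of_mem_roots hb)
  rw [mem_roots hprod, IsRoot.def, eval_prod]
  exact Finset.prod_eq_zero (Finset.mem_univ i) (by simp)

end IsHighest
end CurrentRep

/-! ### From the loop algebra to operators indexed by Laurent polynomials -/

open Polynomial
open LaurentPolynomial hiding C smul_eq_C_mul

theorem exists_eq_smul_add (y : Sl2) : ∃ c₁ c₂ c₃ : ℂ, y = c₁ • e + c₂ • f + c₃ • h := by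
  refine ⟨y.1 0 1, y.1 1 0, y.1 0 0, ?_⟩
  have htr : y.1 0 0 + y.1 1 1 = 0 := by
    rw [← Matrix.trace_fin_two]
    exact y.2
  apply Subtype.ext
  ext i j
  fin_cases i <;> fin_cases j <;> simp [e, f, h]
  linear_combination htr

theorem tmul_lie_tmul_lie {V : Type*} [AddCommGroup V] [Module ℂ V] [LieRingModule LoopSl2 V]
    (p q : ℂ[T;T⁻¹]) (y z : Sl2) (v : V) :
    ⁅(p ⊗ₜ[ℂ] y : LoopSl2), ⁅(q ⊗ₜ[ℂ] z : LoopSl2), v⁆⁆ =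
      ⁅(q ⊗ₜ[ℂ] z : LoopSl2), ⁅(p ⊗ₜ[ℂ] y : LoopSl2), v⁆⁆ +
        ⁅((p * q) ⊗ₜ[ℂ] ⁅y, z⁆ : LoopSl2), v⁆ := by
  rw [leibniz_lie, LieAlgebra.ExtendScalars.bracket_tmul, add_comm]

section LoopRep

variable (V : Type*) [AddCommGroup V] [Module ℂ V] [LieRingModule LoopSl2 V]
  [LieModule ℂ LoopSl2 V]

/-- The operators by which `p ⊗ y` acts. -/
noncomputable def tmulAction (y : Sl2) : ℂ[T;T⁻¹] →ₗ[ℂ] End ℂ V :=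
  (LieModule.toEnd ℂ LoopSl2 V : LoopSl2 →ₗ[ℂ] End ℂ V) ∘ₗ
     (TensorProduct.mk ℂ ℂ[T;T⁻¹] Sl2).flip y

theorem tmulAction_apply (y : Sl2) (p : ℂ[T;T⁻¹]) (v : V) :
    tmulAction V y p v = ⁅(p ⊗ₜ[ℂ] y : LoopSl2), v⁆ := rfl

theorem tmul_smul_lie (c : ℂ) (y : Sl2) (p : ℂ[T;T⁻¹]) (v : V) :
    ⁅(p ⊗ₜ[ℂ] (c • y) : LoopSl2), v⁆ = c • ⁅(p ⊗ₜ[ℂ] y : LoopSl2), v⁆ := by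
  rw [← smul_lie]
  congr 1
  exact TensorProduct.tmul_smul _ _ _

/-- A representation of the loop algebra, as a representation of `ℂ[T;T⁻¹] ⊗ sl₂`. -/
noncomputable def loopRep : CurrentRep ℂ[T;T⁻¹] V where
  E := tmulAction V e
  F := tmulAction V f
  H := tmulAction V h
  E_F p q v := by simp only [tmulAction_apply]; rw [tmul_lie_tmul_lie, e_lie_f]
  H_E p q v := by simp only [tmulAction_apply]; rw [tmul_lie_tmul_lie, h_lie_e, tmul_smul_lie]
  H_F p q v := by
    simp only [tmulAction_apply]
    rw [tmul_lie_tmul_lie, h_lie_f, tmul_smul_lie, neg_smul, sub_eq_add_neg]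
  E_E p q v := by
    simp only [tmulAction_apply]
    rw [tmul_lie_tmul_lie, lie_self, TensorProduct.tmul_zero, zero_lie, add_zero]
  F_F p q v := by
    simp only [tmulAction_apply]
    rw [tmul_lie_tmul_lie, lie_self, TensorProduct.tmul_zero, zero_lie, add_zero]
  H_H p q v := by
    simp only [tmulAction_apply]
    rw [tmul_lie_tmul_lie, lie_self, TensorProduct.tmul_zero, zero_lie, add_zero]

theorem loopRep_F_apply (p : ℂ[T;T⁻¹]) (v : V) :
    (loopRep V).F p v = ⁅(p ⊗ₜ[ℂ] f : LoopSl2), v⁆ := rfl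

variable {V}

theorem stable_lieSubmodule (N : LieSubmodule ℂ LoopSl2 V) : (loopRep V).Stable N.toSubmodule where
  E_mem _ _ hv := N.lie_mem hv
  F_mem _ _ hv := N.lie_mem hv
  H_mem _ _ hv := N.lie_mem hv

theorem lie_mem_of_stable {N : Submodule ℂ V} (hN : (loopRep V).Stable N) (x : LoopSl2) {v : V}
    (hv : v ∈ N) : ⁅x, v⁆ ∈ N := by
  induction x using TensorProduct.induction_on with
  | zero => rw [zero_lie]; exact zero_mem _
  | add x y hx hy => rw [add_lie]; exact add_mem hx hy
  | tmul p y =>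
    obtain ⟨c₁, c₂, c₃, rfl⟩ := exists_eq_smul_add y
    rw [TensorProduct.tmul_add, TensorProduct.tmul_add, add_lie, add_lie, tmul_smul_lie,
      tmul_smul_lie, tmul_smul_lie]
    exact add_mem (add_mem (N.smul_mem _ (hN.E_mem p hv)) (N.smul_mem _ (hN.F_mem p hv)))
      (N.smul_mem _ (hN.H_mem p hv))

/-- The Lie submodule given by an invariant subspace. -/
def lieSubmoduleOfStable {N : Submodule ℂ V} (hN : (loopRep V).Stable N) :
    LieSubmodule ℂ LoopSl2 V where
  __ := N
  lie_mem := lie_mem_of_stable hN _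

theorem isIrreducible_iff_irred [Nontrivial V] :
    LieModule.IsIrreducible ℂ LoopSl2 V ↔ (loopRep V).Irred := by
  constructor
  · intro hirr N hN hne
    rcases hirr.eq_bot_or_eq_top (lieSubmoduleOfStable hN) with h | h
    · exact absurd (congrArg LieSubmodule.toSubmodule h) hne
    · exact congrArg LieSubmodule.toSubmodule h
  · intro hirr
    refine LieModule.IsIrreducible.mk fun N hne => ?_
    rw [← LieSubmodule.toSubmodule_eq_top]
    exact hirr _ (stable_lieSubmodule N) (mt (LieSubmodule.toSubmodule_eq_bot N).mp hne)

end LoopRep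

theorem prod_X_sub_C_eq_sum {s : ℕ} (a : Fin s → ℂ) :
    ∏ i, (X - C (a i)) = ∑ k ∈ Finset.range (s + 1), ((-1 : ℂ) ^ k *
      ∑ I ∈ Finset.powersetCard k (Finset.univ : Finset (Fin s)), ∏ i ∈ I, a i) •
        (X : ℂ[X]) ^ (s - k) := by
  rw [Finset.prod_sub, Finset.sum_powerset, Finset.card_univ, Fintype.card_fin]
  refine Finset.sum_congr rfl fun k _ => ?_
  rw [Finset.mul_sum, Finset.sum_smul]
  refine Finset.sum_congr rfl fun I hI => ?_
  have hcard : I.card = k := (Finset.mem_powersetCard.mp hI).2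
  rw [Finset.prod_const, Finset.card_sdiff_of_subset (Finset.subset_univ I), Finset.card_univ,
    Fintype.card_fin, hcard, smul_eq_C_mul, C_mul, C_pow, C_neg, C_1, map_prod]
  ring

theorem xMinusParam_eq_tmul {s : ℕ} (a : Fin s → ℂ) :
    xMinusParam a = (toLaurentAlg (∏ i, (X - C (a i)))) ⊗ₜ[ℂ] f := by
  rw [prod_X_sub_C_eq_sum, map_sum, TensorProduct.sum_tmul, xMinusParam]
  refine Finset.sum_congr rfl fun k hk => ?_
  rw [map_smul, ← TensorProduct.smul_tmul', map_pow, toLaurentAlg_apply, toLaurent_X, T_pow,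
    mul_one, Nat.cast_sub (Finset.mem_range_succ_iff.mp hk)]
  rfl

/-! ### The representation generated by `Ω` -/

section GenRep

variable {V : Type*} [AddCommGroup V] [Module ℂ V] [LieRingModule LoopSl2 V]
  [LieModule ℂ LoopSl2 V]

theorem coe_toEnd_pow_apply (N : LieSubmodule ℂ LoopSl2 V) (y : LoopSl2) (n : ℕ) (v : N) :
    (((LieModule.toEnd ℂ LoopSl2 N y ^ n) v : N) : V) = (LieModule.toEnd ℂ LoopSl2 V y ^ n) v := by
  induction n with
  | zero => rfl
  | succ n ih =>
    rw [pow_succ', pow_succ', Module.End.mul_apply, Module.End.mul_apply, ← ih]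
    rfl

theorem coe_dividedPower_apply (N : LieSubmodule ℂ LoopSl2 V) (y : LoopSl2) (n : ℕ) (v : N) :
    ((dividedPower (LieModule.toEnd ℂ LoopSl2 N y) n v : N) : V) = divPow y n (v : V) := by
  rw [dividedPower_apply, divPow, LinearMap.smul_apply, ← coe_toEnd_pow_apply]
  rfl

/-- `Ω` as a vector of the representation it generates. -/
def genVector (Ω : V) : genRep Ω := ⟨Ω, LieSubmodule.subset_lieSpan rfl⟩

theorem IsHighestWeightVector.exists_isHighest {Ω : V} (hΩ : IsHighestWeightVector Ω) :
    ∃ D, (loopRep (genRep Ω)).IsHighest (genVector Ω) D := by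
  have hH : ∀ p, ∃ d : ℂ, (loopRep (genRep Ω)).H p (genVector Ω) = d • genVector Ω := by
    intro p
    induction p using LaurentPolynomial.induction_on' with
    | add p q hp hq =>
      obtain ⟨c, hc⟩ := hp
      obtain ⟨d, hd⟩ := hq
      exact ⟨c + d, by rw [map_add, LinearMap.add_apply, hc, hd, add_smul]⟩
    | C_mul_T n c =>
      obtain ⟨d, hd⟩ := hΩ.hGen_lie n
      refine ⟨c * d, ?_⟩
      rw [← LaurentPolynomial.smul_eq_C_mul, map_smul, LinearMap.smul_apply, mul_smul]
      congr 1
      exact Subtype.ext hd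
  choose D hD using hH
  refine ⟨D, fun h0 => hΩ.ne_zero (congrArg Subtype.val h0), fun p => ?_, hD, fun N hN hmem => ?_⟩
  · induction p using LaurentPolynomial.induction_on' with
    | add p q hp hq => rw [map_add, LinearMap.add_apply, hp, hq, add_zero]
    | C_mul_T n c =>
      rw [← LaurentPolynomial.smul_eq_C_mul, map_smul, LinearMap.smul_apply]
      have : (loopRep (genRep Ω)).E (T n) (genVector Ω) = 0 := Subtype.ext (hΩ.xPlus_lie n)
      rw [this, smul_zero]
  -- Generation is a property inside `V`, so the invariant subspace is first pushed forward along
  -- the inclusion.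
  · have hle : genRep Ω ≤ (lieSubmoduleOfStable hN).map (genRep Ω).incl :=
      LieSubmodule.lieSpan_le.mpr <| Set.singleton_subset_iff.mpr
        ((LieSubmodule.mem_map _).mpr ⟨genVector Ω, hmem, rfl⟩)
    refine eq_top_iff.mpr fun v _ => ?_
    obtain ⟨w, hw, hwv⟩ := (LieSubmodule.mem_map _).mp (hle v.2)
    rwa [← Subtype.ext (a1 := w) (a2 := v) hwv]

theorem isIrreducible_genRep_iff (Ω : V) (hΩ : IsHighestWeightVector Ω)
    (hfin : FiniteDimensional ℂ (genRep Ω)) {s : ℕ} (a : Fin s → ℂ) (m : Fin s → ℕ)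
    (ha : HasEvaluationParameters Ω a m) :
    LieModule.IsIrreducible ℂ LoopSl2 (genRep Ω) ↔ ⁅xMinusParam a, Ω⁆ = 0 := by
  obtain ⟨D, hD⟩ := hΩ.exists_isHighest
  have : Nontrivial (genRep Ω) := ⟨⟨genVector Ω, 0, hD.ne_zero⟩⟩
  have hF : (loopRep (genRep Ω)).F (toLaurentAlg (∏ i, (X - C (a i)))) (genVector Ω) = 0 ↔
      ⁅xMinusParam a, Ω⁆ = 0 := by
    rw [loopRep_F_apply, ← xMinusParam_eq_tmul, ← Subtype.coe_inj]
    rfl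
  rw [isIrreducible_iff_irred, ← hF]
  refine ⟨fun hirr => ?_, hD.irred_of_F_prod_eq_zero ha.injective ha.ne_zero⟩
  have hlam : ∀ j, dividedPower ((loopRep (genRep Ω)).E 1) j
      (dividedPower ((loopRep (genRep Ω)).F (T 1)) j (genVector Ω)) =
        eigenval Ω j • genVector Ω := by
    intro j
    have hcoe : (dividedPower ((loopRep (genRep Ω)).E 1) j
        (dividedPower ((loopRep (genRep Ω)).F (T 1)) j (genVector Ω)) : V) =
          divPow (xPlus 0) j (divPow (xMinus 1) j Ω) :=
      (coe_dividedPower_apply (genRep Ω) (xPlus 0) j _).trans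
        (congrArg _ (coe_dividedPower_apply (genRep Ω) (xMinus 1) j (genVector Ω)))
    obtain ⟨c, hc⟩ := hD.exists_dividedPower_apply 1 (T 1) j
    have hex : ∃ c : ℂ, divPow (xPlus 0) j (divPow (xMinus 1) j Ω) = c • Ω :=
      ⟨c, by rw [← hcoe, hc]; rfl⟩
    exact Subtype.ext (hcoe.trans (Classical.epsilon_spec hex))
  have hr : D 1 = weight Ω := by
    obtain ⟨n, hn⟩ := hD.exists_natCast_eq_one
    have hH : ⁅hGen 0, Ω⁆ = D 1 • Ω := congrArg Subtype.val (hD.H_apply 1)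
    have hex : ∃ n : ℕ, ⁅hGen 0, Ω⁆ = (n : ℂ) • Ω := ⟨n, by rw [hH, hn]⟩
    exact smul_left_injective ℂ hΩ.ne_zero (hH.symm.trans (Classical.epsilon_spec hex))
  refine hD.F_prod_eq_zero_of_irred hirr hr (fun j _ => hlam j) fun b hb hsum => ?_
  -- The vanishing sum is the Drinfeld polynomial at `b⁻¹`, so some factor `1 - a_i b⁻¹` is zero.
  have heval : (drinfeldPoly Ω).eval b⁻¹ = 0 := by
    rw [← hsum, drinfeldPoly, eval_finsetSum]
    simp
  rw [ha.factorization, eval_prod, Finset.prod_eq_zero_iff] at heval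
  obtain ⟨i, -, hi⟩ := heval
  refine ⟨i, ?_⟩
  have h0 : 1 - a i * b⁻¹ = 0 := by
    simpa using (pow_eq_zero_iff (ha.mult_pos i).ne').mp (by simpa using hi)
  field_simp at h0
  linear_combination -h0

end GenRep

end Sl2Loop

theorem mainTheorem3 {V : Type*} [AddCommGroup V] [Module ℂ V]
    [LieRingModule Sl2Loop.LoopSl2 V] [LieModule ℂ Sl2Loop.LoopSl2 V]
    (Ω : V) (hΩ : Sl2Loop.IsHighestWeightVector Ω)
    (hfin : FiniteDimensional ℂ (Sl2Loop.genRep Ω))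
    {s : ℕ} (a : Fin s → ℂ) (m : Fin s → ℕ)
    (ha : Sl2Loop.HasEvaluationParameters Ω a m) :
    LieModule.IsIrreducible ℂ Sl2Loop.LoopSl2 (Sl2Loop.genRep Ω) ↔
      ⁅Sl2Loop.xMinusParam a, Ω⁆ = 0 :=
  Sl2Loop.isIrreducible_genRep_iff Ω hΩ hfin a m ha
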